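/- Let $2\le k\le d$ be integers and fix the orthonormal basis $|1\rangle,\dots,|d\rangle$ of $\mathbb C^d$. A state is a positive semidefinite operator of trace $1$ on $\mathbb C^d$; it is incoherent if it is diagonal in this basis. An incoherent Kraus family is a finite family of operators $K_n$ on $\mathbb C^d$ with $\sum_n K_n^\dagger K_n=\mathbb I$ such that for every $n$ and every incoherent state $\delta$ the operator $K_n\delta K_n^\dagger$ is diagonal (that is, incoherent up to normalization). An incoherent operation is a map $\Lambda[X]=\sum_n K_nXK_n^\dagger$ with $\{K_n\}$ an incoherent Kraus family. For a unit vector $|\psi\rangle=\sum_i\psi_i|i\rangle$ the coherence $k$-concurrence is $$C_c^{(k)}(|\psi\rangle)=d\Bigg(\frac1{\binom dk}\sum_{i_1<\cdots<i_k}|\psi_{i_1}|^2\cdots|\psi_{i_k}|^2\Bigg)^{1/k},$$ and for a state $\rho$ it is defined by the convex roof $$C_c^{(k)}(\rho)=\min\sum_a p_a\,C_c^{(k)}(|\psi_a\rangle),$$ over all finite decompositions $\rho=\sum_a p_a|\psi_a\rangle\langle\psi_a|$ with $p_a\ge0$, $\sum_a p_a=1$ and unit vectors $|\psi_a\rangle$.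 Theorem. $C_c^{(k)}$ is well defined (for every state the minimum is attained, and $C_c^{(k)}(|\psi\rangle\langle\psi|)=C_c^{(k)}(|\psi\rangle)$ for every unit vector $|\psi\rangle$), and it is a coherence monotone satisfying: (C1) Nonnegativity: $C_c^{(k)}(\rho)\ge0$ for every state $\rho$. (C2) Monotonicity: $C_c^{(k)}(\Lambda[\rho])\le C_c^{(k)}(\rho)$ for every incoherent operation $\Lambda$ and every state $\rho$. (C3) Strong monotonicity: for every incoherent Kraus family $\{K_n\}$ and every state $\rho$, with $p_n=\operatorname{tr}[K_n\rho K_n^\dagger]$ and $\rho_n=K_n\rho K_n^\dagger/p_n$, one has $\sum_{n:\,p_n\ne 0} p_nC_c^{(k)}(\rho_n)\le C_c^{(k)}(\rho)$. (C4) Convexity: $C_c^{(k)}\big(\sum_ip_i\rho_i\big)\le\sum_ip_iC_c^{(k)}(\rho_i)$ for all finite families of states $\rho_i$ and weights $p_i\ge0$ with $\sum_ip_i=1$. -/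

import Mathlib

/-! Coherence is understood with respect to the standard basis `|i⟩`, `i : Fin d`, of `ℂ^d`.
Operators on `ℂ^d` are complex `d × d` matrices in that basis. -/

namespace CoherenceConcurrence

open scoped ComplexOrder

/-- `ψ` is a normalized vector of `ℂ^d`: `∑ i, |ψ i|² = 1`. -/
def IsPureVector {d : ℕ} (ψ : Fin d → ℂ) : Prop :=
  ∑ i, ‖ψ i‖ ^ 2 = 1

/-- The projector `|ψ⟩⟨ψ|`. -/
def ketbra {d : ℕ} (ψ : Fin d → ℂ) : Matrix (Fin d) (Fin d) ℂ :=
  Matrix.vecMulVec ψ (star ψ)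

/-- `ρ` is a density operator. -/
def IsState {d : ℕ} (ρ : Matrix (Fin d) (Fin d) ℂ) : Prop :=
  ρ.PosSemidef ∧ ρ.trace = 1

/-- `δ` is an incoherent density operator: it is diagonal in the reference basis. -/
def IsIncoherentState {d : ℕ} (δ : Matrix (Fin d) (Fin d) ℂ) : Prop :=
  IsState δ ∧ δ.IsDiag

/-- The elementary symmetric polynomial `S_k` of `|ψ i|²`:
the sum over `i₁ < ⋯ < i_k` of `|ψ i₁|² ⋯ |ψ i_k|²`. -/
noncomputable def symmSq {d : ℕ} (k : ℕ) (ψ : Fin d → ℂ) : ℝ :=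
  ∑ s ∈ Finset.powersetCard k (Finset.univ : Finset (Fin d)), ∏ i ∈ s, ‖ψ i‖ ^ 2

/-- The coherence `k`-concurrence of a pure state vector. -/
noncomputable def pureConcurrence {d : ℕ} (k : ℕ) (ψ : Fin d → ℂ) : ℝ :=
  (d : ℝ) * (symmSq k ψ / (d.choose k : ℝ)) ^ ((1 : ℝ) / (k : ℝ))

/-- The ensemble `{p a, ψ a}` is a decomposition of `ρ` into pure states. -/
def IsDecomposition {d N : ℕ} (ρ : Matrix (Fin d) (Fin d) ℂ) (p : Fin N → ℝ)
    (ψ : Fin N → Fin d → ℂ) : Prop :=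
  (∀ a, 0 ≤ p a) ∧ ∑ a, p a = 1 ∧ (∀ a, IsPureVector (ψ a)) ∧
    ρ = ∑ a, (p a : ℂ) • ketbra (ψ a)

/-- The average pure-state concurrences over all finite pure-state decompositions of `ρ`. -/
def roofValues {d : ℕ} (k : ℕ) (ρ : Matrix (Fin d) (Fin d) ℂ) : Set ℝ :=
  {c | ∃ (N : ℕ) (p : Fin N → ℝ) (ψ : Fin N → Fin d → ℂ),
    IsDecomposition ρ p ψ ∧ c = ∑ a, p a * pureConcurrence k (ψ a)}

/-- The coherence `k`-concurrence of a density operator (convex roof). -/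
noncomputable def concurrence {d : ℕ} (k : ℕ) (ρ : Matrix (Fin d) (Fin d) ℂ) : ℝ :=
  sInf (roofValues k ρ)

/-- `K` is an incoherent Kraus operator: it sends incoherent states to incoherent ones up to
normalization (`K δ Kᴴ` is automatically positive semidefinite, so only diagonality is asked). -/
def IsIncoherentKraus {d : ℕ} (K : Matrix (Fin d) (Fin d) ℂ) : Prop :=
  ∀ δ, IsIncoherentState δ → (K * δ * K.conjTranspose).IsDiag

/-- A complete family of incoherent Kraus operators. -/
def IsIncoherentKrausFamily {d N : ℕ} (K : Fin N → Matrix (Fin d) (Fin d) ℂ) : Prop :=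
  ∑ n, (K n).conjTranspose * K n = 1 ∧ ∀ n, IsIncoherentKraus (K n)

/-- `Λ` is an incoherent operation: it admits a complete family of incoherent Kraus operators. -/
def IsIncoherentOperation {d : ℕ}
    (Λ : Matrix (Fin d) (Fin d) ℂ → Matrix (Fin d) (Fin d) ℂ) : Prop :=
  ∃ (N : ℕ) (K : Fin N → Matrix (Fin d) (Fin d) ℂ), IsIncoherentKrausFamily K ∧
    ∀ X, Λ X = ∑ n, K n * X * (K n).conjTranspose

/-- The probability `tr (K ρ Kᴴ)` of the outcome `K`. -/
noncomputable def outcomeProb {d : ℕ} (K ρ : Matrix (Fin d) (Fin d) ℂ) : ℝ :=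
  (K * ρ * K.conjTranspose).trace.re

/-- The state `K ρ Kᴴ / tr (K ρ Kᴴ)` after the outcome `K`
(meaningful when the outcome has nonzero probability). -/
noncomputable def outcomeState {d : ℕ} (K ρ : Matrix (Fin d) (Fin d) ℂ) :
    Matrix (Fin d) (Fin d) ℂ :=
  ((outcomeProb K ρ : ℂ))⁻¹ • (K * ρ * K.conjTranspose)

/-- (C1) Nonnegativity. -/
def Nonnegativity {d : ℕ} (C : Matrix (Fin d) (Fin d) ℂ → ℝ) : Prop :=
  ∀ ρ, IsState ρ → 0 ≤ C ρ

/-- (C2) Monotonicity under incoherent operations. -/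
def Monotonicity {d : ℕ} (C : Matrix (Fin d) (Fin d) ℂ → ℝ) : Prop :=
  ∀ Λ, IsIncoherentOperation Λ → ∀ ρ, IsState ρ → C (Λ ρ) ≤ C ρ

/-- (C3) Strong monotonicity: monotonicity on average under selective incoherent operations.
Outcomes of probability zero contribute nothing. -/
def StrongMonotonicity {d : ℕ} (C : Matrix (Fin d) (Fin d) ℂ → ℝ) : Prop :=
  ∀ (N : ℕ) (K : Fin N → Matrix (Fin d) (Fin d) ℂ), IsIncoherentKrausFamily K →
    ∀ ρ, IsState ρ → ∑ n, outcomeProb (K n) ρ * C (outcomeState (K n) ρ) ≤ C ρ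

/-- (C4) Convexity. -/
def Convexity {d : ℕ} (C : Matrix (Fin d) (Fin d) ℂ → ℝ) : Prop :=
  ∀ (N : ℕ) (p : Fin N → ℝ) (ρ : Fin N → Matrix (Fin d) (Fin d) ℂ),
    (∀ i, 0 ≤ p i) → ∑ i, p i = 1 → (∀ i, IsState (ρ i)) →
      C (∑ i, (p i : ℂ) • ρ i) ≤ ∑ i, p i * C (ρ i)

end CoherenceConcurrence

/-! On pure states everything reduces to `f = e_k^(1/k)` evaluated at the weights `|ψ i|²`. Three
facts about `f` are used: it is symmetric, homogeneous of degree one, and lies below a linear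
functional with nonnegative coefficients `y` that is tight at an interior point
(`exists_support_elemSymm_rpow`). The last fact is Gårding's inequality: `e_k` has no zero with all
arguments in the upper half-plane, so `t ↦ e_k(w + t x)` is real-rooted, and AM-GM on its roots
gives the bound.

For strong monotonicity on vectors, take `y` nearly tight at `|ψ i|²`. Each column of an incoherent
Kraus operator has at most one nonzero entry, so the `y i` can be permuted over the outputs of `K n`
with no nonzero entry leading to a larger weight. Symmetry of `f` makes the permuted functional a
valid bound for `K n ψ`. The stacked `K n` form an isometry, and `sum_mul_norm_sq_le_of_isometry`
bounds the total by `∑ y i |ψ i|²`, nearly `f`.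

For mixed states, compactness gives optimal ensembles. Transforming, rescaling or concatenating them
gives test ensembles for the roof. -/

namespace CoherenceConcurrence

/-! ### Stability of `e_k` and supporting functionals of `e_k^(1/k)` -/

section SymmetricPolynomials

variable {ι : Type*} [Fintype ι]

/-- The elementary symmetric function `e_k` of a finite family. -/
def elemSymm {R : Type*} [CommSemiring R] (k : ℕ) (x : ι → R) : R :=
  ∑ s ∈ Finset.powersetCard k (Finset.univ : Finset ι), ∏ i ∈ s, x i

open Polynomial

/-- Gauss–Lucas: the open lower half-plane is convex, so it keeps the roots of every derivative. The
bound on `m` keeps these derivatives nonzero. -/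
theorem eval_iterate_derivative_ne_zero_of_roots_im_neg (m : ℕ) (P : ℂ[X])
    (hm : m ≤ P.natDegree) (hP : ∀ z : ℂ, 0 ≤ z.im → P.eval z ≠ 0) :
    ∀ z : ℂ, 0 ≤ z.im → (derivative^[m] P).eval z ≠ 0 := by
  induction m generalizing P with
  | zero => exact hP
  | succ m ih =>
    have hdeg : 0 < P.natDegree := by omega
    refine ih (derivative P) (by rw [natDegree_derivative]; omega) ?_
    intro z hz h0
    have hd : derivative P ≠ 0 := by
      intro h
      have := derivative_eq_zero.1 h
      omega
    have hmem : z ∈ (derivative P).rootSet ℂ := by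
      rw [mem_rootSet]
      exact ⟨hd, by simpa using h0⟩
    have hhull := rootSet_derivative_subset_convexHull_rootSet
      (natDegree_pos_iff_degree_pos.1 hdeg) hmem
    have hsub : P.rootSet ℂ ⊆ {z : ℂ | z.im < 0} := by
      intro w hw
      by_contra hcon
      refine hP w (not_lt.1 hcon) ?_
      simpa using (mem_rootSet.1 hw).2
    have hconv : Convex ℝ {z : ℂ | z.im < 0} := convex_halfSpace_im_lt 0
    exact absurd (convexHull_min hsub hconv hhull) (not_lt.2 hz)

/-- Up to a nonzero factor, `e_k(a)` is the value at `0` of the `(n - k)`-th derivative of `∏ (X + a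
i)`, where `n` is the number of variables. The roots `-a i` lie in the open lower half-plane. -/
theorem elemSymm_ne_zero_of_im_pos {k : ℕ} (hk : k ≤ Fintype.card ι) (a : ι → ℂ)
    (ha : ∀ i, 0 < (a i).im) : elemSymm k a ≠ 0 := by
  set P : ℂ[X] := ∏ i, (X + C (a i)) with hPdef
  have hdeg : P.natDegree = Fintype.card ι := by
    rw [hPdef, natDegree_prod_of_monic _ _ fun i _ => monic_X_add_C _]
    simp
  have hroots : ∀ z : ℂ, 0 ≤ z.im → P.eval z ≠ 0 := by
    intro z hz
    rw [hPdef, eval_prod, Finset.prod_ne_zero_iff]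
    intro i _ h
    have h' := congrArg Complex.im h
    simp only [eval_add, eval_X, eval_C, Complex.add_im, Complex.zero_im] at h'
    linarith [ha i]
  have h := eval_iterate_derivative_ne_zero_of_roots_im_neg (Fintype.card ι - k) P
    (by omega) hroots 0 (by simp)
  rw [← coeff_zero_eq_eval_zero, coeff_iterate_derivative, hPdef,
    Finset.prod_X_add_C_coeff _ _ (by simp)] at h
  intro h0
  apply h
  have : Finset.card (Finset.univ : Finset ι) - (0 + (Fintype.card ι - k)) = k := by
    rw [Finset.card_univ]; omega
  rw [this]
  exact (congrArg _ h0).trans (smul_zero _)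

theorem elemSymm_neg {R : Type*} [CommRing R] (k : ℕ) (a : ι → R) :
    elemSymm k (fun i => -a i) = (-1) ^ k * elemSymm k a := by
  rw [elemSymm, elemSymm, Finset.mul_sum]
  refine Finset.sum_congr rfl fun s hs => ?_
  rw [Finset.prod_neg, (Finset.mem_powersetCard.1 hs).2]

theorem elemSymm_pos {k : ℕ} (hk : k ≤ Fintype.card ι) {x : ι → ℝ} (hx : ∀ i, 0 < x i) :
    0 < elemSymm k x :=
  Finset.sum_pos (fun _ _ => Finset.prod_pos fun i _ => hx i)
    (Finset.powersetCard_nonempty.2 (by simpa using hk))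

theorem elemSymm_nonneg (k : ℕ) {x : ι → ℝ} (hx : ∀ i, 0 ≤ x i) : 0 ≤ elemSymm k x :=
  Finset.sum_nonneg fun _ _ => Finset.prod_nonneg fun i _ => hx i

theorem ofReal_elemSymm (k : ℕ) (x : ι → ℝ) :
    ((elemSymm k x : ℝ) : ℂ) = elemSymm k (fun i => (x i : ℂ)) := by
  simp [elemSymm]

theorem elemSymm_smul {R : Type*} [CommSemiring R] (k : ℕ) (c : R) (x : ι → R) :
    elemSymm k (fun i => c * x i) = c ^ k * elemSymm k x := by
  rw [elemSymm, elemSymm, Finset.mul_sum]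
  refine Finset.sum_congr rfl fun s hs => ?_
  rw [Finset.prod_mul_distrib, Finset.prod_const, (Finset.mem_powersetCard.1 hs).2]

theorem elemSymm_comp_equiv {R : Type*} [CommSemiring R] (k : ℕ) (π : Equiv.Perm ι) (x : ι → R) :
    elemSymm k (fun i => x (π i)) = elemSymm k x := by
  refine Finset.sum_equiv π.finsetCongr (fun s => ?_) (fun s _ => ?_)
  · simp [Finset.mem_powersetCard]
  · simp

theorem continuous_elemSymm (k : ℕ) : Continuous (fun x : ι → ℝ => elemSymm k x) := by
  unfold elemSymm
  fun_prop

theorem multiset_prod_rpow_le_sum_div {k : ℕ} (hk : 0 < k) (M : Multiset ℝ)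
    (hM : ∀ x ∈ M, 0 ≤ x) (hcard : Multiset.card M = k) :
    M.prod ^ ((1 : ℝ) / k) ≤ M.sum / k := by
  induction M using Quotient.inductionOn with
  | h l =>
    have hlen : l.length = k := by simpa using hcard
    subst hlen
    have h := Real.geom_mean_le_arith_mean Finset.univ (fun _ : Fin l.length => (1 : ℝ)) l.get
      (fun _ _ => zero_le_one) (by simpa using hk)
      (fun i _ => hM _ (by simp))
    simp only [Real.rpow_one, Finset.sum_const, Finset.card_univ, Fintype.card_fin, one_mul,
      nsmul_eq_mul, mul_one] at h
    rw [← List.prod_ofFn, ← List.sum_ofFn, List.ofFn_get] at h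
    simpa [one_div] using h

/-- The derivative of `e_k` at `x` in direction `w`, divided by `k`, is at least
`e_k(w)^(1/k) e_k(x)^(1 - 1/k)`. -/
theorem elemSymm_garding {k : ℕ} (hk : 0 < k) (hkc : k ≤ Fintype.card ι) {x w : ι → ℝ}
    (hx : ∀ i, 0 < x i) (hw : ∀ i, 0 ≤ w i) :
    (elemSymm k w / elemSymm k x) ^ ((1 : ℝ) / k) ≤
      (∑ s ∈ Finset.powersetCard k (Finset.univ : Finset ι),
        (∏ i ∈ s, x i) * ∑ i ∈ s, w i / x i) / elemSymm k x / k := by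
  have hE : 0 < elemSymm k x := elemSymm_pos hkc hx
  -- Factoring `w i + x i t = x i (t + w i / x i)` makes the coefficients of `Q(t) = e_k(w + t x)`
  -- readable: `e_k(x)` at degree `k`, the directional derivative at `k - 1`, `e_k(w)` at `0`.
  set T : Finset ι → ℂ[X] := fun s => ∏ i ∈ s, (X + C ((w i / x i : ℝ) : ℂ)) with hT
  have hTmonic : ∀ s, (T s).Monic := fun s => monic_prod_of_monic _ _ fun i _ => monic_X_add_C _
  have hTdeg : ∀ s, (T s).natDegree = s.card := fun s => by
    rw [hT, natDegree_prod_of_monic _ _ fun i _ => monic_X_add_C _]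
    simp
  set Q : ℂ[X] := ∑ s ∈ Finset.powersetCard k (Finset.univ : Finset ι),
    C ((∏ i ∈ s, x i : ℝ) : ℂ) * T s with hQ
  have hQeval : ∀ t : ℂ, Q.eval t = elemSymm k (fun i => (w i : ℂ) + x i * t) := by
    intro t
    rw [hQ, eval_finsetSum, elemSymm]
    refine Finset.sum_congr rfl fun s _ => ?_
    rw [eval_mul, eval_C, hT, eval_prod, Complex.ofReal_prod, ← Finset.prod_mul_distrib]
    refine Finset.prod_congr rfl fun i _ => ?_
    have : (x i : ℂ) ≠ 0 := by exact_mod_cast (hx i).ne'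
    simp only [eval_add, eval_X, eval_C, Complex.ofReal_div]
    field_simp
    ring
  have hcoefk : Q.coeff k = ((elemSymm k x : ℝ) : ℂ) := by
    rw [hQ, finsetSum_coeff, elemSymm, Complex.ofReal_sum]
    refine Finset.sum_congr rfl fun s hs => ?_
    rw [coeff_C_mul, ← (Finset.mem_powersetCard.1 hs).2, ← hTdeg s, (hTmonic s).coeff_natDegree,
      mul_one]
  have hQdeg : Q.natDegree = k := by
    refine natDegree_eq_of_le_of_coeff_ne_zero ?_ ?_
    · refine natDegree_sum_le_of_forall_le _ _ fun s hs => ?_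
      refine (natDegree_C_mul_le _ _).trans ?_
      rw [hTdeg, (Finset.mem_powersetCard.1 hs).2]
    · rw [hcoefk]
      exact_mod_cast hE.ne'
  have hlead : Q.leadingCoeff = ((elemSymm k x : ℝ) : ℂ) := by rw [leadingCoeff, hQdeg, hcoefk]
  have hQ0 : Q ≠ 0 := fun h => by
    rw [h, natDegree_zero] at hQdeg
    omega
  have hnext : Q.nextCoeff = ((∑ s ∈ Finset.powersetCard k (Finset.univ : Finset ι),
        (∏ i ∈ s, x i) * ∑ i ∈ s, w i / x i : ℝ) : ℂ) := by
    rw [nextCoeff_of_natDegree_pos (by omega), hQdeg, hQ, finsetSum_coeff, Complex.ofReal_sum]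
    refine Finset.sum_congr rfl fun s hs => ?_
    have hs' := (Finset.mem_powersetCard.1 hs).2
    have h1 : (T s).coeff (k - 1) = ∑ i ∈ s, ((w i / x i : ℝ) : ℂ) := by
      have h2 := prod_X_sub_C_nextCoeff (s := s) (fun i => -((w i / x i : ℝ) : ℂ))
      simp only [map_neg, sub_neg_eq_add, Finset.sum_neg_distrib, neg_neg] at h2
      rw [← h2, nextCoeff_of_natDegree_pos]
      · rw [← hs', ← hTdeg s]
      · exact (hTdeg s).symm ▸ hs'.symm ▸ hk
    rw [coeff_C_mul, h1]
    push_cast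
    rfl
  have hcoef0 : Q.coeff 0 = ((elemSymm k w : ℝ) : ℂ) := by
    rw [coeff_zero_eq_eval_zero, hQeval, ofReal_elemSymm]
    simp
  have hroots : ∀ r ∈ Q.roots, r.im = 0 ∧ r.re ≤ 0 := by
    intro r hr
    have hr0 : elemSymm k (fun i => (w i : ℂ) + x i * r) = 0 := by
      rw [← hQeval]
      exact (mem_roots hQ0).1 hr
    -- For nonreal `r` all the `w i + x i r` lie in one open half-plane, contradicting stability.
    have him : r.im = 0 := by
      rcases lt_trichotomy r.im 0 with h | h | h
      · refine absurd ?_ (elemSymm_ne_zero_of_im_pos hkc (fun i => -((w i : ℂ) + x i * r)) ?_)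
        · rw [elemSymm_neg, hr0, mul_zero]
        · intro i
          have := mul_neg_of_pos_of_neg (hx i) h
          simpa using this
      · exact h
      · refine absurd hr0 (elemSymm_ne_zero_of_im_pos hkc _ ?_)
        intro i
        have := mul_pos (hx i) h
        simpa using this
    refine ⟨him, ?_⟩
    by_contra hre
    have hr' : r = (r.re : ℂ) := Complex.ext rfl (by simpa using him)
    have hpos : 0 < elemSymm k (fun i => w i + x i * r.re) :=
      elemSymm_pos hkc fun i => add_pos_of_nonneg_of_pos (hw i) (mul_pos (hx i) (not_le.1 hre))
    rw [hr'] at hr0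
    have : ((elemSymm k (fun i => w i + x i * r.re) : ℝ) : ℂ) = 0 := by
      rw [ofReal_elemSymm, ← hr0]
      simp
    exact hpos.ne' (by exact_mod_cast this)
  -- By Vieta the negated roots have product `e_k(w) / e_k(x)` and sum equal to the derivative over
  -- `e_k(x)`; AM-GM compares the two.
  set M : Multiset ℝ := Q.roots.map fun r => -r.re with hM
  have hMroots : M.map (fun t : ℝ => (t : ℂ)) = Q.roots.map fun r => -r := by
    rw [hM, Multiset.map_map]
    refine Multiset.map_congr rfl fun r hr => ?_
    exact Complex.ext (by simp) (by simp [(hroots r hr).1])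
  have hsplit : Q.Splits := IsAlgClosed.splits Q
  have hcard : Multiset.card M = k := by
    rw [hM, Multiset.card_map, ← hsplit.natDegree_eq_card_roots, hQdeg]
  have hprod : M.prod = elemSymm k w / elemSymm k x := by
    have h1 : ((M.prod : ℝ) : ℂ) = (-1) ^ k * Q.roots.prod := by
      rw [← hQdeg, hsplit.natDegree_eq_card_roots, ← Multiset.prod_map_neg, ← hMroots]
      exact map_multiset_prod Complex.ofRealHom M
    have h2 := hsplit.coeff_zero_eq_leadingCoeff_mul_prod_roots
    rw [hcoef0, hlead, hQdeg] at h2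
    rw [eq_div_iff hE.ne']
    have h3 : ((M.prod * elemSymm k x : ℝ) : ℂ) = (elemSymm k w : ℝ) := by
      rw [h2, Complex.ofReal_mul, h1]
      ring
    exact_mod_cast h3
  have hsum : M.sum = (∑ s ∈ Finset.powersetCard k (Finset.univ : Finset ι),
        (∏ i ∈ s, x i) * ∑ i ∈ s, w i / x i) / elemSymm k x := by
    have h1 : ((M.sum : ℝ) : ℂ) = -Q.roots.sum := by
      have h0 : (Q.roots.map fun r => -r).sum = -Q.roots.sum := by
        simp [Multiset.sum_map_neg']
      rw [← h0, ← hMroots]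
      exact map_multiset_sum Complex.ofRealHom M
    have h2 := hsplit.nextCoeff_eq_neg_sum_roots_mul_leadingCoeff
    rw [hnext, hlead] at h2
    rw [eq_div_iff hE.ne']
    refine Complex.ofReal_injective ?_
    rw [Complex.ofReal_mul, h1, h2]
    ring
  rw [← hprod, ← hsum]
  refine multiset_prod_rpow_le_sum_div hk M ?_ hcard
  intro t ht
  obtain ⟨r, hr, rfl⟩ := Multiset.mem_map.1 ht
  linarith [(hroots r hr).2]

/-- `e_k^(1/k)` has a nonnegative supporting linear functional at every point of the open
positive orthant. -/
theorem exists_support_elemSymm_rpow {k : ℕ} (hk : 0 < k) (hkc : k ≤ Fintype.card ι) {x : ι → ℝ}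
    (hx : ∀ i, 0 < x i) :
    ∃ y : ι → ℝ, (∀ i, 0 ≤ y i) ∧ ∑ i, y i * x i = elemSymm k x ^ ((1 : ℝ) / k) ∧
      ∀ w : ι → ℝ, (∀ i, 0 ≤ w i) → elemSymm k w ^ ((1 : ℝ) / k) ≤ ∑ i, y i * w i := by
  classical
  have hE : 0 < elemSymm k x := elemSymm_pos hkc hx
  have hk' : (0 : ℝ) < k := by exact_mod_cast hk
  -- `y` is the gradient of `e_k^(1/k)` at `x`; `c` is the chain-rule factor `e_k(x)^(1/k - 1) / k`.
  set c : ℝ := elemSymm k x ^ ((1 : ℝ) / k) / elemSymm k x / k with hc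
  have hc0 : 0 ≤ c := by positivity
  set y : ι → ℝ := fun i => c * ∑ s ∈ Finset.powersetCard k (Finset.univ : Finset ι),
    if i ∈ s then (∏ j ∈ s, x j) / x i else 0 with hy
  have key : ∀ w : ι → ℝ, ∑ i, y i * w i =
      c * ∑ s ∈ Finset.powersetCard k (Finset.univ : Finset ι),
        (∏ i ∈ s, x i) * ∑ i ∈ s, w i / x i := by
    intro w
    simp only [hy, mul_assoc, Finset.sum_mul]
    rw [← Finset.mul_sum, Finset.sum_comm]
    congr 1
    refine Finset.sum_congr rfl fun s _ => ?_
    rw [Finset.mul_sum, ← Finset.sum_filter_add_sum_filter_not Finset.univ (· ∈ s)]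
    rw [Finset.sum_eq_zero (s := Finset.filter (fun i => ¬ i ∈ s) Finset.univ), add_zero]
    · rw [Finset.filter_mem_eq_inter, Finset.univ_inter]
      refine Finset.sum_congr rfl fun i hi => ?_
      rw [if_pos hi]
      ring
    · intro i hi
      rw [if_neg (Finset.mem_filter.1 hi).2, zero_mul]
  refine ⟨y, fun i => ?_, ?_, fun w hw => ?_⟩
  · refine mul_nonneg hc0 (Finset.sum_nonneg fun s _ => ?_)
    split_ifs
    · exact div_nonneg (Finset.prod_nonneg fun j _ => (hx j).le) (hx i).le
    · exact le_rfl
  · rw [key]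
    have : ∑ s ∈ Finset.powersetCard k (Finset.univ : Finset ι),
        (∏ i ∈ s, x i) * ∑ i ∈ s, x i / x i = elemSymm k x * k := by
      rw [elemSymm, Finset.sum_mul]
      refine Finset.sum_congr rfl fun s hs => ?_
      rw [Finset.sum_congr rfl fun i _ => div_self (hx i).ne']
      simp [(Finset.mem_powersetCard.1 hs).2]
    rw [this, hc]
    field_simp
  · have h := elemSymm_garding hk hkc hx hw
    rw [Real.div_rpow (elemSymm_nonneg k hw) hE.le,
      div_le_iff₀ (Real.rpow_pos_of_pos hE _)] at h
    rw [key, hc]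
    refine h.trans (le_of_eq ?_)
    ring

/-- Near-optimal version at boundary points of the orthant. -/
theorem exists_approx_support_elemSymm_rpow {k : ℕ} (hk : 0 < k) (hkc : k ≤ Fintype.card ι)
    {x : ι → ℝ} (hx : ∀ i, 0 ≤ x i) {ε : ℝ} (hε : 0 < ε) :
    ∃ y : ι → ℝ, (∀ i, 0 ≤ y i) ∧ ∑ i, y i * x i ≤ elemSymm k x ^ ((1 : ℝ) / k) + ε ∧
      ∀ w : ι → ℝ, (∀ i, 0 ≤ w i) → elemSymm k w ^ ((1 : ℝ) / k) ≤ ∑ i, y i * w i := by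
  have hcont : Continuous fun t : ℝ => elemSymm k (fun i => x i + t) ^ ((1 : ℝ) / k) :=
    ((continuous_elemSymm k).comp (by fun_prop)).rpow_const fun _ => Or.inr (by positivity)
  have hev : ∀ᶠ t in nhds (0 : ℝ), elemSymm k (fun i => x i + t) ^ ((1 : ℝ) / k) <
      elemSymm k x ^ ((1 : ℝ) / k) + ε := by
    refine hcont.continuousAt.eventually_lt continuousAt_const ?_
    simpa using hε
  obtain ⟨δ, hδ, hball⟩ := Metric.eventually_nhds_iff.1 hev
  have hδ2 : 0 < δ / 2 := by positivity
  have hlt := hball (y := δ / 2) (by rw [Real.dist_eq, sub_zero, abs_of_pos hδ2]; linarith)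
  -- Support at a point moved into the open orthant. Since `y ≥ 0`, moving back to `x` only lowers
  -- the functional.
  obtain ⟨y, hy0, hyx, hyw⟩ := exists_support_elemSymm_rpow hk hkc
    (x := fun i => x i + δ / 2) fun i => add_pos_of_nonneg_of_pos (hx i) hδ2
  refine ⟨y, hy0, ?_, hyw⟩
  calc ∑ i, y i * x i ≤ ∑ i, y i * (x i + δ / 2) :=
        Finset.sum_le_sum fun i _ => mul_le_mul_of_nonneg_left (by linarith) (hy0 i)
    _ ≤ _ := hyx ▸ hlt.le

end SymmetricPolynomials

open scoped ComplexOrder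

/-! ### Layer-cake comparison for isometries -/

section Layers

variable {ι κ : Type*} [Fintype ι] [Fintype κ]

/-- Layer cake: each weight `u` is the integral of `1_{t ≤ u}` over `[0, B]`, with `B` a common
upper bound. -/
theorem sum_mul_le_sum_mul_of_layers {y b : ι → ℝ} {z c : κ → ℝ} (hy : ∀ i, 0 ≤ y i)
    (hz : ∀ a, 0 ≤ z a)
    (h : ∀ t : ℝ, ∑ a, (if t ≤ z a then c a else 0) ≤ ∑ i, (if t ≤ y i then b i else 0)) :
    ∑ a, z a * c a ≤ ∑ i, y i * b i := by
  set B : ℝ := ∑ a, z a + ∑ i, y i with hB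
  have hzB : ∀ a, z a ≤ B := fun a =>
    (Finset.single_le_sum (fun a _ => hz a) (Finset.mem_univ a)).trans
      (le_add_of_nonneg_right (Finset.sum_nonneg fun i _ => hy i))
  have hyB : ∀ i, y i ≤ B := fun i =>
    (Finset.single_le_sum (fun i _ => hy i) (Finset.mem_univ i)).trans
      (le_add_of_nonneg_left (Finset.sum_nonneg fun a _ => hz a))
  have hB0 : 0 ≤ B :=
    add_nonneg (Finset.sum_nonneg fun a _ => hz a) (Finset.sum_nonneg fun i _ => hy i)
  have layer : ∀ u v : ℝ, 0 ≤ u → u ≤ B →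
      IntervalIntegrable (fun t => if t ≤ u then v else 0) MeasureTheory.volume 0 B ∧
        ∫ t in (0 : ℝ)..B, (if t ≤ u then v else 0) = u * v := by
    intro u v hu huB
    have heq : (fun t : ℝ => if t ≤ u then v else 0) =
        Set.indicator {t | t ≤ u} (fun _ => v) := by
      ext t
      simp [Set.indicator_apply]
    constructor
    · rw [heq, intervalIntegrable_iff]
      exact (MeasureTheory.integrableOn_const (by simp)).indicator measurableSet_Iic
    · rw [heq, intervalIntegral.integral_indicator ⟨hu, huB⟩]
      simp
  have hl : ∑ a, z a * c a = ∫ t in (0 : ℝ)..B, ∑ a, (if t ≤ z a then c a else 0) := by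
    rw [intervalIntegral.integral_finsetSum fun a _ => (layer (z a) (c a) (hz a) (hzB a)).1]
    exact Finset.sum_congr rfl fun a _ => (layer (z a) (c a) (hz a) (hzB a)).2.symm
  have hr : ∑ i, y i * b i = ∫ t in (0 : ℝ)..B, ∑ i, (if t ≤ y i then b i else 0) := by
    rw [intervalIntegral.integral_finsetSum fun i _ => (layer (y i) (b i) (hy i) (hyB i)).1]
    exact Finset.sum_congr rfl fun i _ => (layer (y i) (b i) (hy i) (hyB i)).2.symm
  rw [hl, hr]
  refine intervalIntegral.integral_mono_on hB0 ?_ ?_ fun t _ => h t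
  · simpa only [Finset.sum_fn] using
      IntervalIntegrable.sum Finset.univ fun a _ => (layer (z a) (c a) (hz a) (hzB a)).1
  · simpa only [Finset.sum_fn] using
      IntervalIntegrable.sum Finset.univ fun i _ => (layer (y i) (b i) (hy i) (hyB i)).1

/-- If `V` is an isometry and every entry `V a i ≠ 0` satisfies `z a ≤ y i`, then
`Vᴴ diag(z) V ≤ diag(y)`. -/
theorem sum_mul_norm_sq_le_of_isometry (V : κ → ι → ℂ)
    (hV : ∀ φ : ι → ℂ, ∑ a, ‖∑ i, V a i * φ i‖ ^ 2 = ∑ i, ‖φ i‖ ^ 2) {y : ι → ℝ} {z : κ → ℝ}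
    (hy : ∀ i, 0 ≤ y i) (hz : ∀ a, 0 ≤ z a) (hzy : ∀ a i, V a i ≠ 0 → z a ≤ y i) (φ : ι → ℂ) :
    ∑ a, z a * ‖∑ i, V a i * φ i‖ ^ 2 ≤ ∑ i, y i * ‖φ i‖ ^ 2 := by
  refine sum_mul_le_sum_mul_of_layers hy hz fun t => ?_
  calc ∑ a, (if t ≤ z a then ‖∑ i, V a i * φ i‖ ^ 2 else 0)
      ≤ ∑ a, ‖∑ i, V a i * (if t ≤ y i then φ i else 0)‖ ^ 2 := by
        refine Finset.sum_le_sum fun a _ => ?_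
        split_ifs with hta
        -- If `t ≤ z a`, row `a` only sees indices with `t ≤ y i`, so truncating `φ` to them changes
        -- nothing.
        · refine le_of_eq ?_
          congr 2
          refine Finset.sum_congr rfl fun i _ => ?_
          by_cases h0 : V a i = 0
          · simp [h0]
          · rw [if_pos (hta.trans (hzy a i h0))]
        · positivity
    _ = ∑ i, ‖if t ≤ y i then φ i else 0‖ ^ 2 := hV _
    _ = _ := by
        refine Finset.sum_congr rfl fun i _ => ?_
        split_ifs <;> simp

end Layers

/-! ### Incoherent Kraus operators acting on vectors -/

section Kraus

variable {d : ℕ}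

/-- Test on `|i⟩⟨i|`: the `(a, b)` entry of the output is `K a i * conj (K b i)`. -/
theorem IsIncoherentKraus.eq_of_ne_zero {K : Matrix (Fin d) (Fin d) ℂ} (hK : IsIncoherentKraus K)
    {a b i : Fin d} (ha : K a i ≠ 0) (hb : K b i ≠ 0) : a = b := by
  by_contra hab
  have hstate : IsIncoherentState (Matrix.diagonal (Pi.single i (1 : ℂ))) := by
    refine ⟨⟨Matrix.PosSemidef.diagonal ?_, ?_⟩, Matrix.isDiag_diagonal _⟩
    · intro j
      by_cases h : j = i
      · subst h; simp
      · simp [h]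
    · simp [Matrix.trace_diagonal]
  have h : (K * Matrix.diagonal (Pi.single i (1 : ℂ)) * K.conjTranspose) a b = 0 :=
    hK _ hstate hab
  rw [Matrix.mul_apply] at h
  simp only [Matrix.mul_diagonal, Matrix.conjTranspose_apply] at h
  rw [Finset.sum_eq_single i (by intro j _ hj; simp [hj]) (by simp)] at h
  simp [ha, hb] at h

/-- Rows have disjoint supports, so sending each nonzero row to a minimizer of `y` on its support is
injective. Zero rows impose no condition, and any extension to a permutation works. -/
theorem IsIncoherentKraus.exists_perm {K : Matrix (Fin d) (Fin d) ℂ} (hK : IsIncoherentKraus K)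
    (y : Fin d → ℝ) : ∃ π : Equiv.Perm (Fin d), ∀ j i, K j i ≠ 0 → y (π j) ≤ y i := by
  classical
  have hmin : ∀ j : {j // ∃ i, K j i ≠ 0}, ∃ i, K j.1 i ≠ 0 ∧ ∀ i', K j.1 i' ≠ 0 → y i ≤ y i' := by
    intro j
    obtain ⟨i, hi, hle⟩ := Finset.exists_min_image (Finset.univ.filter fun i => K j.1 i ≠ 0) y
      (by obtain ⟨i, hi⟩ := j.2; exact ⟨i, by simpa using hi⟩)
    exact ⟨i, by simpa using hi, fun i' hi' => hle i' (by simpa using hi')⟩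
  choose g hg hgle using hmin
  have hinj : Function.Injective g := by
    intro j j' h
    exact Subtype.ext (hK.eq_of_ne_zero (hg j) (h ▸ hg j'))
  let e : {j // ∃ i, K j i ≠ 0} ≃ {i // i ∈ Set.range g} := Equiv.ofInjective g hinj
  refine ⟨e.extendSubtype, fun j i hji => ?_⟩
  rw [e.extendSubtype_apply_of_mem j ⟨i, hji⟩]
  exact hgle ⟨j, i, hji⟩ i hji

theorem sum_norm_sq_mulVec {N : ℕ} {K : Fin N → Matrix (Fin d) (Fin d) ℂ}
    (hK : ∑ n, (K n).conjTranspose * K n = 1) (φ : Fin d → ℂ) :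
    ∑ n, ∑ j, ‖(K n).mulVec φ j‖ ^ 2 = ∑ i, ‖φ i‖ ^ 2 := by
  have hnorm : ∀ v : Fin d → ℂ, ((∑ i, ‖v i‖ ^ 2 : ℝ) : ℂ) = star v ⬝ᵥ v := by
    intro v
    simp only [dotProduct, Pi.star_apply, Complex.ofReal_sum, RCLike.star_def]
    refine Finset.sum_congr rfl fun i _ => ?_
    rw [Complex.conj_mul']
    push_cast
    rfl
  refine Complex.ofReal_injective ?_
  rw [Complex.ofReal_sum, hnorm]
  simp only [hnorm]
  calc ∑ n, star ((K n).mulVec φ) ⬝ᵥ (K n).mulVec φ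
      = ∑ n, star φ ⬝ᵥ ((K n).conjTranspose * K n).mulVec φ := by
        refine Finset.sum_congr rfl fun n _ => ?_
        rw [Matrix.star_mulVec, ← Matrix.dotProduct_mulVec, Matrix.mulVec_mulVec]
    _ = star φ ⬝ᵥ (∑ n, (K n).conjTranspose * K n).mulVec φ := by
        rw [Matrix.sum_mulVec, dotProduct_sum]
    _ = star φ ⬝ᵥ φ := by rw [hK, Matrix.one_mulVec]

theorem symmSq_eq_elemSymm (k : ℕ) (ψ : Fin d → ℂ) :
    symmSq k ψ = elemSymm k (fun i => ‖ψ i‖ ^ 2) := rfl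

theorem symmSq_nonneg (k : ℕ) (ψ : Fin d → ℂ) : 0 ≤ symmSq k ψ :=
  elemSymm_nonneg k fun _ => by positivity

/-- Strong monotonicity of `S_k^(1/k)` on vectors. -/
theorem sum_symmSq_rpow_mulVec_le {k N : ℕ} (hk : 0 < k) (hkd : k ≤ d)
    {K : Fin N → Matrix (Fin d) (Fin d) ℂ} (hK : IsIncoherentKrausFamily K) (ψ : Fin d → ℂ) :
    ∑ n, symmSq k ((K n).mulVec ψ) ^ ((1 : ℝ) / k) ≤ symmSq k ψ ^ ((1 : ℝ) / k) := by
  -- Some `ψ i` may vanish, so only an approximate support is at hand.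
  refine le_of_forall_pos_le_add fun ε hε => ?_
  obtain ⟨y, hy0, hyψ, hy⟩ := exists_approx_support_elemSymm_rpow hk
    (by simpa using hkd) (x := fun i => ‖ψ i‖ ^ 2) (fun i => by positivity) hε
  choose π hπ using fun n => (hK.2 n).exists_perm y
  have hbound : ∀ n, symmSq k ((K n).mulVec ψ) ^ ((1 : ℝ) / k) ≤
      ∑ j, y (π n j) * ‖(K n).mulVec ψ j‖ ^ 2 := by
    intro n
    rw [symmSq_eq_elemSymm, ← elemSymm_comp_equiv k (π n).symm]
    refine (hy _ fun i => by positivity).trans (le_of_eq ?_)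
    rw [← Equiv.sum_comp (π n)]
    simp
  -- Completeness of the family says exactly that the operators stacked over `(n, j)` form an
  -- isometry.
  have hiso := sum_mul_norm_sq_le_of_isometry (κ := Fin N × Fin d) (fun a i => K a.1 a.2 i)
    (fun φ => by
      rw [Fintype.sum_prod_type]
      exact sum_norm_sq_mulVec hK.1 φ)
    (z := fun a => y (π a.1 a.2)) hy0 (fun a => hy0 _) (fun a i h => hπ a.1 a.2 i h) ψ
  rw [Fintype.sum_prod_type] at hiso
  exact (Finset.sum_le_sum fun n _ => hbound n).trans (hiso.trans hyψ)

theorem pureConcurrence_eq (k : ℕ) (ψ : Fin d → ℂ) :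
    pureConcurrence k ψ =
      d * ((d.choose k : ℝ)⁻¹) ^ ((1 : ℝ) / k) * symmSq k ψ ^ ((1 : ℝ) / k) := by
  rw [pureConcurrence, div_eq_mul_inv, Real.mul_rpow (symmSq_nonneg k ψ) (by positivity)]
  ring

theorem pureConcurrence_nonneg (k : ℕ) (ψ : Fin d → ℂ) : 0 ≤ pureConcurrence k ψ := by
  have := symmSq_nonneg k ψ
  unfold pureConcurrence
  positivity

theorem sum_pureConcurrence_mulVec_le {k N : ℕ} (hk : 0 < k) (hkd : k ≤ d)
    {K : Fin N → Matrix (Fin d) (Fin d) ℂ} (hK : IsIncoherentKrausFamily K) (ψ : Fin d → ℂ) :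
    ∑ n, pureConcurrence k ((K n).mulVec ψ) ≤ pureConcurrence k ψ := by
  simp only [pureConcurrence_eq]
  rw [← Finset.mul_sum]
  exact mul_le_mul_of_nonneg_left (sum_symmSq_rpow_mulVec_le hk hkd hK ψ) (by positivity)

theorem pureConcurrence_smul {k : ℕ} (hk : 0 < k) (c : ℂ) (ψ : Fin d → ℂ) :
    pureConcurrence k (c • ψ) = ‖c‖ ^ 2 * pureConcurrence k ψ := by
  have h : symmSq k (c • ψ) = (‖c‖ ^ 2) ^ k * symmSq k ψ := by
    rw [symmSq_eq_elemSymm, symmSq_eq_elemSymm, ← elemSymm_smul]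
    simp [mul_pow]
  rw [pureConcurrence_eq, pureConcurrence_eq, h, Real.mul_rpow (by positivity) (symmSq_nonneg k ψ),
    one_div, Real.pow_rpow_inv_natCast (by positivity) hk.ne']
  ring

theorem continuous_pureConcurrence (k : ℕ) :
    Continuous (pureConcurrence k : (Fin d → ℂ) → ℝ) := by
  unfold pureConcurrence symmSq
  exact continuous_const.mul
    (Continuous.rpow_const (by fun_prop) fun _ => Or.inr (by positivity))

end Kraus

/-! ### Attainment of the convex roof -/

/-- In finite dimension the convex hull of a compact set is compact. -/
theorem isCompact_convexHull_of_finiteDimensional {E : Type*} [AddCommGroup E] [Module ℝ E]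
    [FiniteDimensional ℝ E] [TopologicalSpace E] [ContinuousAdd E] [ContinuousSMul ℝ E]
    {s : Set E} (hs : IsCompact s) : IsCompact (convexHull ℝ s) := by
  -- Carathéodory: `finrank + 1` points suffice, so the hull is a finite union of continuous images
  -- of compact sets.
  have heq : convexHull ℝ s = ⋃ m ∈ Set.Iic (Module.finrank ℝ E + 1),
      (fun q : (Fin m → ℝ) × (Fin m → E) => ∑ i, q.1 i • q.2 i) ''
        (stdSimplex ℝ (Fin m) ×ˢ Set.pi Set.univ fun _ => s) := by
    apply Set.Subset.antisymm
    · intro x hx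
      obtain ⟨ι, _, z, w, hz, haff, hw0, hw1, hwz⟩ := eq_pos_convex_span_of_mem_convexHull hx
      have e := (Fintype.equivFin ι).symm
      have hcard : Fintype.card ι ≤ Module.finrank ℝ E + 1 :=
        haff.card_le_finrank_succ.trans (Nat.succ_le_succ (Submodule.finrank_le _))
      refine Set.mem_biUnion hcard ⟨(w ∘ e, z ∘ e), ⟨⟨fun i => (hw0 _).le, ?_⟩, fun i _ =>
        hz (Set.mem_range_self _)⟩, ?_⟩
      · rw [← hw1]
        exact e.sum_comp w
      · rw [← hwz]
        exact e.sum_comp fun i => w i • z i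
    · refine Set.iUnion₂_subset fun m _ => ?_
      rintro _ ⟨⟨w, z⟩, ⟨hw, hz⟩, rfl⟩
      exact mem_convexHull_of_exists_fintype w z hw.1 hw.2 (fun i => hz i trivial) rfl
  rw [heq]
  refine (Set.finite_Iic _).isCompact_biUnion fun m _ => ?_
  refine ((isCompact_stdSimplex ℝ (Fin m)).prod (isCompact_univ_pi fun _ => hs)).image ?_
  fun_prop

variable {d : ℕ}

theorem isCompact_setOf_isPureVector : IsCompact {ψ : Fin d → ℂ | IsPureVector ψ} := by
  refine Metric.isCompact_of_isClosed_isBounded ?_ ?_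
  · exact isClosed_eq (by fun_prop) continuous_const
  · refine (Metric.isBounded_closedBall (x := (0 : Fin d → ℂ)) (r := 1)).subset fun ψ hψ => ?_
    rw [mem_closedBall_zero_iff, pi_norm_le_iff_of_nonneg zero_le_one]
    intro i
    have h : ‖ψ i‖ ^ 2 ≤ 1 := by
      rw [← (show ∑ i, ‖ψ i‖ ^ 2 = 1 from hψ)]
      exact Finset.single_le_sum (f := fun i => ‖ψ i‖ ^ 2) (fun _ _ => by positivity)
        (Finset.mem_univ i)
    exact (sq_le_one_iff₀ (norm_nonneg _)).1 h

theorem continuous_ketbra : Continuous (ketbra : (Fin d → ℂ) → Matrix (Fin d) (Fin d) ℂ) :=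
  continuous_id.matrix_vecMulVec continuous_star

/-- The roof values form a fibre of the convex hull of a compact graph; the hull absorbs the
unbounded ensemble length. -/
theorem roofValues_eq_slice (k : ℕ) (ρ : Matrix (Fin d) (Fin d) ℂ) :
    roofValues k ρ = {c | (ρ, c) ∈ convexHull ℝ
      ((fun ψ : Fin d → ℂ => (ketbra ψ, pureConcurrence k ψ)) '' {ψ | IsPureVector ψ})} := by
  ext c
  constructor
  · rintro ⟨N, p, ψ, ⟨hp0, hp1, hψ, hρ⟩, hc⟩
    refine mem_convexHull_of_exists_fintype p (fun a => (ketbra (ψ a), pureConcurrence k (ψ a)))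
      hp0 hp1 (fun a => ⟨ψ a, hψ a, rfl⟩) ?_
    rw [hρ, hc]
    refine Prod.ext ?_ ?_
    · simp [Prod.fst_sum]
    · simp [Prod.snd_sum]
  · intro h
    obtain ⟨ι, _, w, z, hw0, hw1, hz, hx⟩ := mem_convexHull_iff_exists_fintype.1 h
    choose ψ hψ hψz using hz
    have e := (Fintype.equivFin ι).symm
    refine ⟨Fintype.card ι, w ∘ e, ψ ∘ e, ⟨fun a => hw0 _, ?_, fun a => hψ _, ?_⟩, ?_⟩
    · rw [← hw1]
      exact e.sum_comp w
    · have h1 := congrArg Prod.fst hx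
      rw [Prod.fst_sum] at h1
      refine h1.symm.trans ?_
      rw [← e.sum_comp]
      refine Finset.sum_congr rfl fun a _ => ?_
      rw [← hψz]
      simp
    · have h1 := congrArg Prod.snd hx
      rw [Prod.snd_sum] at h1
      refine h1.symm.trans ?_
      rw [← e.sum_comp]
      refine Finset.sum_congr rfl fun a _ => ?_
      rw [← hψz]
      simp

theorem isCompact_roofValues (k : ℕ) (ρ : Matrix (Fin d) (Fin d) ℂ) :
    IsCompact (roofValues k ρ) := by
  have hΩ : IsCompact (convexHull ℝ
      ((fun ψ : Fin d → ℂ => (ketbra ψ, pureConcurrence k ψ)) '' {ψ | IsPureVector ψ})) :=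
    isCompact_convexHull_of_finiteDimensional (isCompact_setOf_isPureVector.image
      (continuous_ketbra.prodMk (continuous_pureConcurrence k)))
  rw [roofValues_eq_slice]
  have : {c | (ρ, c) ∈ convexHull ℝ
      ((fun ψ : Fin d → ℂ => (ketbra ψ, pureConcurrence k ψ)) '' {ψ | IsPureVector ψ})} =
      Prod.snd '' (convexHull ℝ
      ((fun ψ : Fin d → ℂ => (ketbra ψ, pureConcurrence k ψ)) '' {ψ | IsPureVector ψ}) ∩
        Prod.fst ⁻¹' {ρ}) := by
    ext c
    constructor
    · exact fun h => ⟨(ρ, c), ⟨h, rfl⟩, rfl⟩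
    · rintro ⟨⟨σ, c'⟩, ⟨h, hσ⟩, rfl⟩
      obtain rfl : σ = ρ := hσ
      exact h
  rw [this]
  exact (hΩ.inter_right (isClosed_singleton.preimage continuous_fst)).image continuous_snd

/-! ### Subnormalized ensembles -/

theorem trace_ketbra (φ : Fin d → ℂ) : (ketbra φ).trace = ((∑ i, ‖φ i‖ ^ 2 : ℝ) : ℂ) := by
  rw [ketbra, Matrix.trace_vecMulVec, Complex.ofReal_sum]
  refine Finset.sum_congr rfl fun i _ => ?_
  rw [Pi.star_apply, RCLike.star_def, Complex.mul_conj']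
  push_cast
  rfl

theorem ketbra_smul (c : ℂ) (φ : Fin d → ℂ) :
    ketbra (c • φ) = ((‖c‖ ^ 2 : ℝ) : ℂ) • ketbra φ := by
  rw [ketbra, ketbra, star_smul, Matrix.smul_vecMulVec, Matrix.vecMulVec_smul, smul_smul,
    RCLike.star_def, Complex.mul_conj']
  push_cast
  rfl

theorem ketbra_sqrt_smul {p : ℝ} (hp : 0 ≤ p) (φ : Fin d → ℂ) :
    ketbra (((√p : ℝ) : ℂ) • φ) = (p : ℂ) • ketbra φ := by
  rw [ketbra_smul, Complex.norm_real, Real.norm_eq_abs, sq_abs, Real.sq_sqrt hp]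

theorem pureConcurrence_sqrt_smul {k : ℕ} (hk : 0 < k) {p : ℝ} (hp : 0 ≤ p) (φ : Fin d → ℂ) :
    pureConcurrence k (((√p : ℝ) : ℂ) • φ) = p * pureConcurrence k φ := by
  rw [pureConcurrence_smul hk, Complex.norm_real, Real.norm_eq_abs, sq_abs, Real.sq_sqrt hp]

theorem exists_eq_sqrt_smul_isPureVector (hd : 0 < d) (φ : Fin d → ℂ) :
    ∃ ψ : Fin d → ℂ, IsPureVector ψ ∧ φ = ((√(∑ i, ‖φ i‖ ^ 2) : ℝ) : ℂ) • ψ := by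
  set p : ℝ := ∑ i, ‖φ i‖ ^ 2 with hp
  have hp0 : 0 ≤ p := Finset.sum_nonneg fun i _ => by positivity
  rcases hp0.eq_or_lt with h0 | hpos
  -- A zero vector has weight `0`, so any unit vector serves.
  · refine ⟨Pi.single ⟨0, hd⟩ 1, ?_, ?_⟩
    · rw [IsPureVector, Finset.sum_eq_single ⟨0, hd⟩]
      · simp
      · intro j _ hj
        simp [hj]
      · simp
    · rw [← h0]
      ext i
      have h := (Finset.sum_eq_zero_iff_of_nonneg fun i _ => by positivity).1 (hp ▸ h0.symm) i
        (Finset.mem_univ i)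
      simpa using h
  · have hs : (((√p : ℝ)) : ℂ) ≠ 0 := by
      exact_mod_cast (Real.sqrt_pos.2 hpos).ne'
    refine ⟨((√p : ℝ) : ℂ)⁻¹ • φ, ?_, ?_⟩
    · rw [IsPureVector]
      simp only [Pi.smul_apply, smul_eq_mul, norm_mul, norm_inv, mul_pow, Complex.norm_real,
        Real.norm_eq_abs, inv_pow, sq_abs, Real.sq_sqrt hp0]
      rw [← Finset.mul_sum, ← hp, inv_mul_cancel₀ hpos.ne']
    · rw [smul_smul, mul_inv_cancel₀ hs, one_smul]

/-- Sub-normalized ensembles also compute elements of `roofValues`. -/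
theorem sum_pureConcurrence_mem_roofValues {ι : Type*} [Fintype ι] {k : ℕ} (hk : 0 < k)
    (hd : 0 < d) {ρ : Matrix (Fin d) (Fin d) ℂ} (hρ : ρ.trace = 1) (φ : ι → Fin d → ℂ)
    (hφ : ρ = ∑ a, ketbra (φ a)) : ∑ a, pureConcurrence k (φ a) ∈ roofValues k ρ := by
  choose ψ hψ hφψ using fun a => exists_eq_sqrt_smul_isPureVector hd (φ a)
  set p : ι → ℝ := fun a => ∑ i, ‖φ a i‖ ^ 2 with hp
  have hp0 : ∀ a, 0 ≤ p a := fun a => Finset.sum_nonneg fun i _ => by positivity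
  have e := (Fintype.equivFin ι).symm
  refine ⟨Fintype.card ι, p ∘ e, ψ ∘ e, ⟨fun a => hp0 _, ?_, fun a => hψ _, ?_⟩, ?_⟩
  · refine (e.sum_comp p).trans ?_
    refine Complex.ofReal_injective ?_
    rw [Complex.ofReal_one, ← hρ, hφ, Matrix.trace_sum, Complex.ofReal_sum]
    exact Finset.sum_congr rfl fun a _ => (trace_ketbra _).symm
  · rw [hφ]
    refine Eq.trans ?_ (e.sum_comp fun a => (p a : ℂ) • ketbra (ψ a)).symm
    refine Finset.sum_congr rfl fun a _ => ?_
    conv_lhs => rw [hφψ a]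
    exact ketbra_sqrt_smul (hp0 a) _
  · refine Eq.trans ?_ (e.sum_comp fun a => p a * pureConcurrence k (ψ a)).symm
    refine Finset.sum_congr rfl fun a _ => ?_
    conv_lhs => rw [hφψ a]
    exact pureConcurrence_sqrt_smul hk (hp0 a) _

/-- `pureConcurrence` and `ketbra` both scale by `‖c‖²`, so the weights are absorbed as `√(p a)`. -/
theorem exists_ensemble_of_mem_roofValues {k : ℕ} (hk : 0 < k) {ρ : Matrix (Fin d) (Fin d) ℂ}
    {c : ℝ} (hc : c ∈ roofValues k ρ) : ∃ (N : ℕ) (φ : Fin N → Fin d → ℂ),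
      ρ = ∑ a, ketbra (φ a) ∧ c = ∑ a, pureConcurrence k (φ a) := by
  obtain ⟨N, p, ψ, ⟨hp0, _, _, hρ⟩, hc⟩ := hc
  refine ⟨N, fun a => ((√(p a) : ℝ) : ℂ) • ψ a, ?_, ?_⟩
  · rw [hρ]
    exact Finset.sum_congr rfl fun a _ => (ketbra_sqrt_smul (hp0 a) _).symm
  · rw [hc]
    exact Finset.sum_congr rfl fun a _ => (pureConcurrence_sqrt_smul hk (hp0 a) _).symm

theorem roofValues_nonempty {k : ℕ} (hk : 0 < k) (hd : 0 < d) {ρ : Matrix (Fin d) (Fin d) ℂ}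
    (hρ : IsState ρ) : (roofValues k ρ).Nonempty := by
  obtain ⟨m, v, hv⟩ := Matrix.posSemidef_iff_eq_sum_vecMulVec.1 hρ.1
  exact ⟨_, sum_pureConcurrence_mem_roofValues hk hd hρ.2 v hv⟩

theorem roofValues_nonneg {k : ℕ} {ρ : Matrix (Fin d) (Fin d) ℂ} {c : ℝ}
    (hc : c ∈ roofValues k ρ) : 0 ≤ c := by
  obtain ⟨N, p, ψ, ⟨hp0, _, _, _⟩, rfl⟩ := hc
  exact Finset.sum_nonneg fun a _ => mul_nonneg (hp0 a) (pureConcurrence_nonneg k _)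

theorem isLeast_concurrence {k : ℕ} (hk : 0 < k) (hd : 0 < d) {ρ : Matrix (Fin d) (Fin d) ℂ}
    (hρ : IsState ρ) : IsLeast (roofValues k ρ) (concurrence k ρ) :=
  (isCompact_roofValues k ρ).isLeast_sInf (roofValues_nonempty hk hd hρ)

theorem concurrence_nonneg (k : ℕ) (ρ : Matrix (Fin d) (Fin d) ℂ) : 0 ≤ concurrence k ρ :=
  Real.sInf_nonneg fun _ hc => roofValues_nonneg hc

theorem concurrence_le_sum {ι : Type*} [Fintype ι] {k : ℕ} (hk : 0 < k) (hd : 0 < d)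
    {ρ : Matrix (Fin d) (Fin d) ℂ} (hρ : ρ.trace = 1) (φ : ι → Fin d → ℂ)
    (hφ : ρ = ∑ a, ketbra (φ a)) : concurrence k ρ ≤ ∑ a, pureConcurrence k (φ a) :=
  csInf_le ⟨0, fun _ hc => roofValues_nonneg hc⟩
    (sum_pureConcurrence_mem_roofValues hk hd hρ φ hφ)

theorem exists_optimal_ensemble {k : ℕ} (hk : 0 < k) (hd : 0 < d) {ρ : Matrix (Fin d) (Fin d) ℂ}
    (hρ : IsState ρ) : ∃ (N : ℕ) (φ : Fin N → Fin d → ℂ),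
      ρ = ∑ a, ketbra (φ a) ∧ concurrence k ρ = ∑ a, pureConcurrence k (φ a) :=
  exists_ensemble_of_mem_roofValues hk (isLeast_concurrence hk hd hρ).1

theorem isState_ketbra {ψ : Fin d → ℂ} (hψ : IsPureVector ψ) : IsState (ketbra ψ) := by
  refine ⟨Matrix.posSemidef_vecMulVec_self_star ψ, ?_⟩
  rw [trace_ketbra, show ∑ i, ‖ψ i‖ ^ 2 = 1 from hψ, Complex.ofReal_one]

theorem dotProduct_ketbra_mulVec (v φ : Fin d → ℂ) :
    star v ⬝ᵥ (ketbra φ).mulVec v = ((‖star v ⬝ᵥ φ‖ ^ 2 : ℝ) : ℂ) := by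
  have h : star φ ⬝ᵥ v = star (star v ⬝ᵥ φ) := by
    rw [Matrix.star_dotProduct]
  rw [ketbra, Matrix.vecMulVec_mulVec, dotProduct_smul, h, op_smul_eq_mul,
    RCLike.star_def, Complex.mul_conj']
  push_cast
  rfl

/-- The members of an ensemble of a pure state are multiples of that state vector. -/
theorem exists_smul_of_ketbra_eq_sum {ι : Type*} [Fintype ι] {ψ : Fin d → ℂ} (hψ : IsPureVector ψ)
    {φ : ι → Fin d → ℂ} (h : ketbra ψ = ∑ a, ketbra (φ a)) (b : ι) : ∃ c : ℂ, φ b = c • ψ := by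
  have hnorm : star ψ ⬝ᵥ ψ = 1 := by
    rw [← (isState_ketbra hψ).2, ketbra, Matrix.trace_vecMulVec, dotProduct_comm]
  set c : ℂ := star ψ ⬝ᵥ φ b with hc
  refine ⟨c, ?_⟩
  -- `v` is the part of `φ b` orthogonal to `ψ`. Testing the decomposition on `v` gives `∑ ‖⟨v, φ
  -- a⟩‖² = 0`, hence `⟨v, v⟩ = 0`.
  set v : Fin d → ℂ := φ b - c • ψ with hv
  have hψv : star ψ ⬝ᵥ v = 0 := by
    rw [hv, dotProduct_sub, dotProduct_smul, hnorm, ← hc]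
    simp
  have hvψ : star v ⬝ᵥ ψ = 0 := by
    have h1 := congrArg star hψv
    rwa [← Matrix.star_dotProduct_star, star_star, star_zero] at h1
  have hsum : ∑ a, ‖star v ⬝ᵥ φ a‖ ^ 2 = 0 := by
    refine Complex.ofReal_injective ?_
    rw [Complex.ofReal_sum, Complex.ofReal_zero]
    simp only [← dotProduct_ketbra_mulVec]
    rw [← dotProduct_sum, ← Matrix.sum_mulVec, ← h, dotProduct_ketbra_mulVec, hvψ]
    simp
  have hb : star v ⬝ᵥ φ b = 0 := by
    simpa using (Finset.sum_eq_zero_iff_of_nonneg fun a _ => by positivity).1 hsum b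
      (Finset.mem_univ b)
  have hvv : star v ⬝ᵥ v = 0 := by
    conv_lhs => rw [hv, dotProduct_sub, dotProduct_smul, ← hv, hb, hvψ]
    simp
  exact sub_eq_zero.1 (dotProduct_star_self_eq_zero.1 hvv)

/-- Every ensemble of `ketbra ψ` consists of `c a • ψ` with `∑ ‖c a‖² = 1`, so all roof values
coincide. -/
theorem concurrence_ketbra {k : ℕ} (hk : 0 < k) (hd : 0 < d) {ψ : Fin d → ℂ}
    (hψ : IsPureVector ψ) : concurrence k (ketbra ψ) = pureConcurrence k ψ := by
  obtain ⟨N, φ, hφ, hc⟩ := exists_optimal_ensemble hk hd (isState_ketbra hψ)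
  choose c hcψ using exists_smul_of_ketbra_eq_sum hψ hφ
  have hsum : ∑ a, ‖c a‖ ^ 2 = 1 := by
    refine Complex.ofReal_injective ?_
    have h := congrArg Matrix.trace hφ
    simp only [hcψ, ketbra_smul, Matrix.trace_sum, Matrix.trace_smul, (isState_ketbra hψ).2,
      smul_eq_mul, mul_one] at h
    rw [Complex.ofReal_sum, Complex.ofReal_one, ← h]
  rw [hc]
  simp only [hcψ, pureConcurrence_smul hk]
  rw [← Finset.sum_mul, hsum, one_mul]

/-! ### Convexity and monotonicity of the roof -/

theorem mul_ketbra_mul_conjTranspose (K : Matrix (Fin d) (Fin d) ℂ) (φ : Fin d → ℂ) :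
    K * ketbra φ * K.conjTranspose = ketbra (K.mulVec φ) := by
  rw [ketbra, ketbra, Matrix.mul_vecMulVec, Matrix.vecMulVec_mul, Matrix.star_mulVec]

theorem mul_sum_ketbra_mul_conjTranspose {ι : Type*} [Fintype ι] (K : Matrix (Fin d) (Fin d) ℂ)
    (φ : ι → Fin d → ℂ) :
    K * (∑ a, ketbra (φ a)) * K.conjTranspose = ∑ a, ketbra (K.mulVec (φ a)) := by
  rw [Matrix.mul_sum, Matrix.sum_mul]
  exact Finset.sum_congr rfl fun a _ => mul_ketbra_mul_conjTranspose K (φ a)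

/-- Optimal ensembles of the `ρ i`, scaled by `√(p i)` and concatenated, form an ensemble of the
mixture. -/
theorem convexity_concurrence {k : ℕ} (hk : 0 < k) (hd : 0 < d) :
    Convexity (d := d) (concurrence k) := by
  intro N p ρ hp0 hp1 hρ
  choose M φ hφ hc using fun i => exists_optimal_ensemble hk hd (hρ i)
  have htr : (∑ i, (p i : ℂ) • ρ i).trace = 1 := by
    simp only [Matrix.trace_sum, Matrix.trace_smul, (hρ _).2, smul_eq_mul, mul_one]
    exact_mod_cast hp1
  refine (concurrence_le_sum hk hd htr
    (fun a : Σ i, Fin (M i) => ((√(p a.1) : ℝ) : ℂ) • φ a.1 a.2) ?_).trans (le_of_eq ?_)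
  · rw [Fintype.sum_sigma]
    refine Finset.sum_congr rfl fun i _ => ?_
    conv_lhs => rw [hφ i, Finset.smul_sum]
    exact Finset.sum_congr rfl fun a _ => (ketbra_sqrt_smul (hp0 i) _).symm
  · rw [Fintype.sum_sigma]
    refine Finset.sum_congr rfl fun i _ => ?_
    rw [hc i, Finset.mul_sum]
    exact Finset.sum_congr rfl fun a _ => pureConcurrence_sqrt_smul hk (hp0 i) _

/-- The vectors `K n φ a`, over all outcomes and members of an optimal ensemble, form an ensemble of
`Λ ρ`. -/
theorem monotonicity_concurrence {k : ℕ} (hk : 0 < k) (hd : 0 < d) (hkd : k ≤ d) :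
    Monotonicity (d := d) (concurrence k) := by
  rintro Λ ⟨N, K, hK, hΛ⟩ ρ hρ
  obtain ⟨M, φ, hφ, hc⟩ := exists_optimal_ensemble hk hd hρ
  have htr : (Λ ρ).trace = 1 := by
    rw [hΛ, Matrix.trace_sum]
    simp only [Matrix.trace_mul_cycle (K _) ρ, ← Matrix.trace_sum, ← Matrix.sum_mul]
    rw [hK.1, Matrix.one_mul, hρ.2]
  refine (concurrence_le_sum hk hd htr
    (fun q : Fin M × Fin N => (K q.2).mulVec (φ q.1)) ?_).trans ?_
  · rw [hΛ, hφ, Fintype.sum_prod_type_right]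
    exact Finset.sum_congr rfl fun n _ => mul_sum_ketbra_mul_conjTranspose _ _
  · rw [hc, Fintype.sum_prod_type]
    exact Finset.sum_le_sum fun a _ => sum_pureConcurrence_mulVec_le hk hkd hK (φ a)

theorem outcomeProb_mul_concurrence_le {ι : Type*} [Fintype ι] {k : ℕ} (hk : 0 < k) (hd : 0 < d)
    (K : Matrix (Fin d) (Fin d) ℂ) (φ : ι → Fin d → ℂ) :
    outcomeProb K (∑ a, ketbra (φ a)) * concurrence k (outcomeState K (∑ a, ketbra (φ a))) ≤
      ∑ a, pureConcurrence k (K.mulVec (φ a)) := by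
  set ρ := ∑ a, ketbra (φ a) with hρ
  have htr : (K * ρ * K.conjTranspose).trace = (outcomeProb K ρ : ℂ) := by
    rw [outcomeProb, hρ, mul_sum_ketbra_mul_conjTranspose, Matrix.trace_sum]
    simp only [trace_ketbra, ← Complex.ofReal_sum, Complex.ofReal_re]
  have hp0 : 0 ≤ outcomeProb K ρ := by
    rw [outcomeProb, hρ, mul_sum_ketbra_mul_conjTranspose, Matrix.trace_sum]
    simp only [trace_ketbra, ← Complex.ofReal_sum, Complex.ofReal_re]
    positivity
  -- At probability zero the factor kills the meaningless `outcomeState`. Otherwise the vectors `K φ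
  -- a` divided by the square root of the probability form an ensemble.
  rcases hp0.eq_or_lt with h0 | hpos
  · rw [← h0, zero_mul]
    exact Finset.sum_nonneg fun a _ => pureConcurrence_nonneg k _
  · have hinv : 0 ≤ (outcomeProb K ρ)⁻¹ := inv_nonneg.2 hp0
    have hle := concurrence_le_sum hk hd (ρ := outcomeState K ρ)
      (by
        rw [outcomeState, Matrix.trace_smul, htr, smul_eq_mul, inv_mul_cancel₀]
        exact_mod_cast hpos.ne')
      (fun a => ((√((outcomeProb K ρ)⁻¹) : ℝ) : ℂ) • K.mulVec (φ a))
      (by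
        simp only [ketbra_sqrt_smul hinv]
        rw [outcomeState, ← Finset.smul_sum, ← mul_sum_ketbra_mul_conjTranspose,
          Complex.ofReal_inv])
    simp only [pureConcurrence_sqrt_smul hk hinv] at hle
    rw [← Finset.mul_sum] at hle
    rwa [← le_inv_mul_iff₀ hpos]

theorem strongMonotonicity_concurrence {k : ℕ} (hk : 0 < k) (hd : 0 < d) (hkd : k ≤ d) :
    StrongMonotonicity (d := d) (concurrence k) := by
  intro N K hK ρ hρ
  obtain ⟨M, φ, hφ, hc⟩ := exists_optimal_ensemble hk hd hρ
  calc ∑ n, outcomeProb (K n) ρ * concurrence k (outcomeState (K n) ρ)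
      ≤ ∑ n, ∑ a, pureConcurrence k ((K n).mulVec (φ a)) :=
        Finset.sum_le_sum fun n _ => hφ ▸ outcomeProb_mul_concurrence_le hk hd (K n) φ
    _ = ∑ a, ∑ n, pureConcurrence k ((K n).mulVec (φ a)) := Finset.sum_comm
    _ ≤ ∑ a, pureConcurrence k (φ a) :=
        Finset.sum_le_sum fun a _ => sum_pureConcurrence_mulVec_le hk hkd hK (φ a)
    _ = concurrence k ρ := hc.symm

end CoherenceConcurrence

theorem mainTheorem1 (d k : ℕ) (hk : 2 ≤ k) (hkd : k ≤ d) :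
    (∀ ρ : Matrix (Fin d) (Fin d) ℂ, CoherenceConcurrence.IsState ρ →
      IsLeast (CoherenceConcurrence.roofValues k ρ) (CoherenceConcurrence.concurrence k ρ)) ∧
    (∀ ψ : Fin d → ℂ, CoherenceConcurrence.IsPureVector ψ →
      CoherenceConcurrence.concurrence k (CoherenceConcurrence.ketbra ψ) =
        CoherenceConcurrence.pureConcurrence k ψ) ∧
    CoherenceConcurrence.Nonnegativity (d := d) (CoherenceConcurrence.concurrence k) ∧
    CoherenceConcurrence.Monotonicity (d := d) (CoherenceConcurrence.concurrence k) ∧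
    CoherenceConcurrence.StrongMonotonicity (d := d) (CoherenceConcurrence.concurrence k) ∧
    CoherenceConcurrence.Convexity (d := d) (CoherenceConcurrence.concurrence k) := by

  have hk0 : 0 < k := by omega
  have hd : 0 < d := by omega
  exact ⟨fun ρ hρ => CoherenceConcurrence.isLeast_concurrence hk0 hd hρ,
    fun ψ hψ => CoherenceConcurrence.concurrence_ketbra hk0 hd hψ,
    fun ρ _ => CoherenceConcurrence.concurrence_nonneg k ρ,
    CoherenceConcurrence.monotonicity_concurrence hk0 hd hkd,
    CoherenceConcurrence.strongMonotonicity_concurrence hk0 hd hkd,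
    CoherenceConcurrence.convexity_concurrence hk0 hd⟩
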